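/- Let $\mathcal X$ be a measurable space (for instance a subset of $\mathbb R^p$) and $\mathcal Y$ a standard Borel space (for instance a Borel subset of $\mathbb R^d$). Let $(X,Y)$ have a distribution $\mathbb P$ on $\mathcal X\times\mathcal Y$, and let $S=((x^{(i)},y^{(i)}))_{i=1}^m$, $m\ge 1$, be an i.i.d. sample from $\mathbb P$. Let $\ell:\mathcal Y\times\mathcal Y\to[0,L]$ be a measurable loss, and let $k:\mathcal X\times\mathcal X\to\mathbb R$ be a measurable, symmetric, positive (semi)definite kernel with $\sup_{x}k(x,x)\le\kappa$ and reproducing kernel Hilbert space $\mathcal H$. For $\lambda>0$ and $y\in\mathcal Y$ let $\hat R(y|\cdot)\in\mathcal H$ be the minimizer over $f\in\mathcal H$ of $$\frac1m\sum_{i=1}^m\bigl(f(x^{(i)})-\ell(y,y^{(i)})\bigr)^2+\lambda\|f\|_{\mathcal H}^2 ,$$ and let $\hat h$ be a predictor with $\hat h(x)\in\arg\min_{y\in\mathcal Y}\hat R(y|x)$ for all $x$ (minimizers are assumed to exist); ties may be broken in any way such that $\ell(\hat h(X),Y)$ is a random variable for each fixed training sample, and the choice may even depend on the label $y$ in $\ell(\hat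 h(x),y)$, for instance so as to incur the highest loss. For $\rho>0$ define the surrogate loss $$L^\rho_{\hat R}(x,y)=\min\Bigl\{L,\ \sup_{y'\in\mathcal Y}\Bigl[\ell(y',y)+\frac1\rho\Bigl(\inf_{y''\in\mathcal Y}\hat R(y''|x)-\hat R(y'|x)\Bigr)\Bigr]\Bigr\},$$ and let $\mathfrak R(\hat h)=\mathbb E_{(X,Y)\sim\mathbb P}[\ell(\hat h(X),Y)]$ and $\hat{\mathfrak R}^\rho(\hat h)=\frac1m\sum_{i=1}^m L^\rho_{\hat R}(x^{(i)},y^{(i)})$. Then for any $\rho>0$, $\lambda>0$ and $\delta\in(0,1)$, with probability at least $1-\delta$ over the sample $S$, $$\mathfrak R(\hat h)\le\hat{\mathfrak R}^\rho(\hat h)+\frac{4L\nu}{\rho m}+L\Bigl(\frac{8\nu}{\rho}+1\Bigr)\sqrt{\frac{\ln(1/\delta)}{2m}},\qquad \nu:=\frac\kappa\lambda+\Bigl(\frac\kappa\lambda\Bigr)^{3/2}.$$ -/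

import Mathlib

open MeasureTheory

namespace ECRM

noncomputable section

variable {X Y : Type*} {m : ℕ}

/-- The regularized least squares objective over a reproducing kernel Hilbert space `H` of real
functions on `X`, for the sample `S` and the candidate label `y`:
`(1/m) ∑ i, (f (x i) - ℓ (y, y i)) ^ 2 + lam * ‖f‖ ^ 2`. -/
def ridgeObjective {H : Type*} [NormedAddCommGroup H] [InnerProductSpace ℝ H] [RKHS ℝ H X ℝ]
    (ℓ : Y → Y → ℝ) (lam : ℝ) (S : Fin m → X × Y) (y : Y) (f : H) : ℝ :=
  (1 / (m : ℝ)) * ∑ i, (f (S i).1 - ℓ y (S i).2) ^ 2 + lam * ‖f‖ ^ 2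

/-- `R y` is, for every label `y`, a solution of the kernel ridge regression problem: `R y x` is the
estimated conditional risk of predicting the label `y` at the input `x`. -/
def IsRiskEstimate {H : Type*} [NormedAddCommGroup H] [InnerProductSpace ℝ H] [RKHS ℝ H X ℝ]
    (ℓ : Y → Y → ℝ) (lam : ℝ) (S : Fin m → X × Y) (R : Y → H) : Prop :=
  ∀ (y : Y) (f : H), ridgeObjective ℓ lam S y (R y) ≤ ridgeObjective ℓ lam S y f

/-- `h` predicts a minimizer of the estimated conditional risk `R · x` at every input `x`.
The choice among several minimizers is free, and may depend on the true label `y` against which the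
prediction is evaluated; so the convention "among the minimizers, take one that incurs the highest
loss" is included, as is every ordinary predictor (for which `h x y` does not depend on `y`). -/
def IsPredictor (R : Y → X → ℝ) (h : X → Y → Y) : Prop :=
  ∀ (x : X) (y y' : Y), R (h x y) x ≤ R y' x

/-- `Δ_R (y', x) = min_{y''} R (y'' | x) - R (y' | x)`. -/
def gap (R : Y → X → ℝ) (y' : Y) (x : X) : ℝ :=
  (⨅ y'' : Y, R y'' x) - R y' x

/-- The surrogate loss `Φ (max_{y'} (ℓ (y', y) + Δ_R (y', x) / ρ))`, where `Φ a = min a L`. -/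
def surrogateLoss (ℓ : Y → Y → ℝ) (L ρ : ℝ) (R : Y → X → ℝ) (x : X) (y : Y) : ℝ :=
  min (⨆ y' : Y, (ℓ y' y + (1 / ρ) * gap R y' x)) L

/-- The expected risk `E [ℓ (h X, Y)]` of a predictor. -/
def expectedRisk [MeasurableSpace X] [MeasurableSpace Y] (ℓ : Y → Y → ℝ) (μ : Measure (X × Y))
    (h : X → Y → Y) : ℝ :=
  ∫ z, ℓ (h z.1 z.2) z.2 ∂μ

/-- The empirical risk with respect to the surrogate loss. -/
def empiricalSurrogateRisk (ℓ : Y → Y → ℝ) (L ρ : ℝ) (R : Y → X → ℝ) (S : Fin m → X × Y) : ℝ :=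
  (1 / (m : ℝ)) * ∑ i, surrogateLoss ℓ L ρ R (S i).1 (S i).2

end

end ECRM

/-!
The argument is algorithmic stability followed by a bounded differences inequality, applied to the
surrogate loss `T S z` of the risk estimate trained on the sample `S`, evaluated at `z = (x, y)`.

*Stability.* Comparing the normal equations of kernel ridge regression for two samples that differ
in one point shows that `R S y x` moves by at most `2 L ν / m`, uniformly in `x` and `y`
(`IsRiskEstimate.abs_sub_update_le`). The surrogate loss is `2 / ρ`-Lipschitz in the risk estimate,
so `T` moves by at most `β = 4 L ν / (ρ m)` (`abs_surrogateLoss_sub_le`).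

*Concentration.* The gap between the population mean and the empirical mean of `T S` has expectation
at most `β`, because exchanging the `i`-th training point with a fresh one preserves the product
measure (`measurePreserving_update`), and it moves by at most `2 β + L / m` when one point of the
sample changes. McDiarmid's inequality (`hasSubgaussianMGF_of_bounded_differences`, from Hoeffding's
lemma by induction on the sample size) gives the bound for `∫ T S`
(`exists_generalization_bound_of_uniform_stability`). Finally `∫ T S` dominates the risk of every
predictor, since the gap vanishes at a minimizer (`le_surrogateLoss_of_minimizer`).

*Measurability.* The surrogate loss is a supremum over the possibly uncountable label space, so it
need not be measurable jointly in the sample and the point. It is universally measurable: the risk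
estimate is jointly measurable by the representer formula (`IsRiskEstimate.apply_eq`), and the
projection of a measurable set along a standard Borel space is null measurable for every finite
measure (`nullMeasurableSet_image_fst`), because analytic sets are. Universal measurability passes
to sections, to compositions with measurable maps and to partial integrals, which is all that the
concentration argument requires.
-/

/-! ### Measurable projections and universal measurability -/

namespace ECRM

open Set Filter Topology

theorem isCompact_setOf_forall_le (n : ℕ → ℕ) : IsCompact {x : ℕ → ℕ | ∀ i, x i ≤ n i} := by
  have := isCompact_univ_pi (fun i => (Set.finite_Iic (n i)).isCompact)
  convert this using 1
  ext y; simp [Pi.le_def]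

/-- A tube lemma: an open set containing the compact box `∏ [0, n i]` already contains a cylinder
that constrains only finitely many coordinates. -/
theorem exists_cylinder_subset {U : Set (ℕ → ℕ)} (hU : IsOpen U) (n : ℕ → ℕ)
    (hK : {x : ℕ → ℕ | ∀ i, x i ≤ n i} ⊆ U) :
    ∃ k, {x : ℕ → ℕ | ∀ i < k, x i ≤ n i} ⊆ U := by
  by_contra! hcon
  have hne : ∀ k, ∃ x : ℕ → ℕ, (∀ i < k, x i ≤ n i) ∧ x ∉ U := fun k => by
    simpa [Set.not_subset] using hcon k
  choose x hx hxU using hne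
  obtain ⟨a, ha, φ, hφ, hlim⟩ := (isCompact_setOf_forall_le n).tendsto_subseq
    (x := fun k i => min (x k i) (n i)) (fun k i => min_le_right _ _)
  have hlim' : Tendsto (fun j => x (φ j)) atTop (𝓝 a) := by
    rw [tendsto_pi_nhds] at hlim ⊢
    intro i
    refine (hlim i).congr' ?_
    filter_upwards [eventually_gt_atTop i] with j hj
    exact min_eq_left (hx (φ j) i (hj.trans_le (hφ.id_le j)))
  obtain ⟨j, hj⟩ := (hlim'.eventually (hU.mem_nhds (hK ha))).exists
  exact hxU _ hj

/-- Capacitability of analytic sets: an analytic set is approximated from inside by compact sets.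
The bounds on the coordinates in `ℕ → ℕ` are chosen one at a time, keeping the outer measure of the
image above `r`; this uses that outer measures are continuous along increasing sequences of
arbitrary sets. -/
theorem exists_compact_subset_range {α : Type*} [TopologicalSpace α] [MeasurableSpace α]
    (μ : Measure α) [μ.OuterRegular] {f : (ℕ → ℕ) → α} (hf : Continuous f) {r : ENNReal}
    (hr : r < μ (range f)) : ∃ K ⊆ range f, IsCompact K ∧ r ≤ μ K := by
  have step : ∀ (k : ℕ) (D : Set (ℕ → ℕ)), r < μ (f '' D) →
      ∃ N, r < μ (f '' (D ∩ {x | x k ≤ N})) := by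
    intro k D hD
    have hun : f '' D = ⋃ N, f '' (D ∩ {x | x k ≤ N}) := by
      rw [← image_iUnion, ← inter_iUnion]
      congr 1
      refine (inter_eq_left.2 fun x _ => ?_).symm
      exact mem_iUnion.2 ⟨x k, le_refl (x k)⟩
    have hmono : Monotone fun N => f '' (D ∩ {x : ℕ → ℕ | x k ≤ N}) := fun a b hab =>
      image_mono (inter_subset_inter_right _ fun x hx => le_trans hx hab)
    rw [hun, hmono.measure_iUnion] at hD
    exact lt_iSup_iff.1 hD
  choose! G hG using step
  -- `D k` is the cylinder cut out by the first `k` bounds.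
  let D : ℕ → Set (ℕ → ℕ) := fun k => Nat.rec univ (fun k D => D ∩ {x | x k ≤ G k D}) k
  have hD : ∀ k, r < μ (f '' D k) := by
    intro k
    induction k with
    | zero => simpa [D] using hr
    | succ k ih => exact hG k _ ih
  have hDn : ∀ k, D k = {x | ∀ i < k, x i ≤ G i (D i)} := by
    intro k
    induction k with
    | zero => ext x; simp [D]
    | succ k ih =>
      change D k ∩ {x | x k ≤ G k (D k)} = _
      ext x
      have : x ∈ D k ↔ ∀ i < k, x i ≤ G i (D i) := by
        constructor
        · intro h; rw [ih] at h; exact h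
        · intro h; rw [ih]; exact h
      rw [mem_inter_iff, this, mem_ofPred_eq, mem_ofPred_eq]
      exact (Nat.forall_lt_succ_right (p := fun i => x i ≤ G i (D i))).symm
  refine ⟨f '' {x | ∀ i, x i ≤ G i (D i)}, image_subset_range _ _,
    (isCompact_setOf_forall_le _).image hf, ?_⟩
  by_contra! hlt
  obtain ⟨U, hKU, hUo, hUr⟩ := Set.exists_isOpen_lt_of_lt _ _ hlt
  obtain ⟨k, hk⟩ := exists_cylinder_subset (hUo.preimage hf) _ (image_subset_iff.1 hKU)
  rw [← hDn k] at hk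
  exact lt_asymm hUr ((hD k).trans_le (measure_mono (image_subset_iff.2 hk)))

theorem nullMeasurableSet_of_analyticSet {α : Type*} [TopologicalSpace α] [T2Space α]
    [MeasurableSpace α] [BorelSpace α] (μ : Measure α) [IsFiniteMeasure μ] [μ.OuterRegular]
    {A : Set α} (hA : AnalyticSet A) : NullMeasurableSet A μ := by
  rw [AnalyticSet] at hA
  obtain rfl | ⟨f, hf, rfl⟩ := hA
  · exact nullMeasurableSet_empty
  rcases eq_or_ne (μ (range f)) 0 with h0 | h0
  · exact NullMeasurableSet.of_null h0
  obtain ⟨r, -, hr, hlim⟩ := exists_seq_strictMono_tendsto' (pos_iff_ne_zero.2 h0)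
  choose K hKsub hK hrK using fun n => exists_compact_subset_range μ hf (hr n).2
  have hmeas : NullMeasurableSet (⋃ n, K n) μ :=
    (MeasurableSet.iUnion fun n => (hK n).measurableSet).nullMeasurableSet
  refine hmeas.congr (ae_eq_of_subset_of_measure_ge (iUnion_subset hKsub) ?_ hmeas
    (measure_ne_top _ _))
  exact le_of_tendsto' hlim fun n => (hrK n).trans (measure_mono (subset_iUnion K n))

/-- A measurable subset of `Ω × Y` involves only countably many measurable subsets of `Ω`, hence it
is pulled back from `(ℕ → Bool) × Y`. This replaces the arbitrary measurable space `Ω` by a Polish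
one. -/
theorem exists_factorization_of_measurableSet_prod {Ω Y : Type*} [MeasurableSpace Ω]
    [MeasurableSpace Y] {A : Set (Ω × Y)} (hA : MeasurableSet A) :
    ∃ (φ : Ω → ℕ → Bool) (B : Set ((ℕ → Bool) × Y)), Measurable φ ∧ MeasurableSet B ∧
      A = Prod.map φ id ⁻¹' B := by
  classical
  induction A, hA using MeasurableSpace.induction_on_inter generateFrom_prod.symm
    isPiSystem_prod with
  | empty => exact ⟨fun _ _ => false, ∅, measurable_const, .empty, rfl⟩
  | basic t ht =>
    obtain ⟨s, hs, u, hu, rfl⟩ := ht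
    refine ⟨fun ω _ => decide (ω ∈ s), {c | c 0 = true} ×ˢ u, ?_, ?_, ?_⟩
    · exact measurable_pi_lambda _ fun _ => measurable_to_bool (by
        convert (show MeasurableSet s from hs) using 1; ext; simp)
    · exact (measurableSet_eq_fun (measurable_pi_apply 0) measurable_const).prod hu
    · ext ⟨ω, y⟩; simp
  | compl t _ ih =>
    obtain ⟨φ, B, hφ, hB, rfl⟩ := ih
    exact ⟨φ, Bᶜ, hφ, hB.compl, rfl⟩
  | iUnion s _ _ ih =>
    choose φ B hφ hB hs using ih
    refine ⟨fun ω j => φ j.unpair.1 ω j.unpair.2,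
      ⋃ n, Prod.map (fun (c : ℕ → Bool) k => c (Nat.pair n k)) id ⁻¹' B n, ?_, ?_, ?_⟩
    · exact measurable_pi_lambda _ fun j => (measurable_pi_apply _).comp (hφ _)
    · refine MeasurableSet.iUnion fun n => (Measurable.prodMap ?_ measurable_id) (hB n)
      exact measurable_pi_lambda _ fun k => measurable_pi_apply _
    · ext ⟨ω, y⟩
      simp only [mem_iUnion, mem_preimage, Prod.map_apply, id, Nat.unpair_pair]
      refine exists_congr fun n => ?_
      nth_rw 1 [hs n]
      rfl

/-- The measurable projection theorem, for the completion of a finite measure. -/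
theorem nullMeasurableSet_image_fst {Ω Y : Type*} [MeasurableSpace Ω] [MeasurableSpace Y]
    [StandardBorelSpace Y] (μ : Measure Ω) [IsFiniteMeasure μ] {A : Set (Ω × Y)}
    (hA : MeasurableSet A) : NullMeasurableSet (Prod.fst '' A) μ := by
  obtain ⟨φ, B, hφ, hB, rfl⟩ := exists_factorization_of_measurableSet_prod hA
  have hproj : Prod.fst '' (Prod.map φ id ⁻¹' B) = φ ⁻¹' (Prod.fst '' B) := by
    ext ω; simp
  rw [hproj]
  have := nullMeasurableSet_of_analyticSet (μ.map φ) (hB.analyticSet_image measurable_fst)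
  exact this.preimage ⟨hφ, Measure.AbsolutelyContinuous.rfl⟩

/-- A real function is universally measurable if it is almost everywhere measurable for every finite
measure. -/
def UniversallyMeasurable {α : Type*} [MeasurableSpace α] (f : α → ℝ) : Prop :=
  ∀ (μ : Measure α) [IsFiniteMeasure μ], AEMeasurable f μ

theorem UniversallyMeasurable.comp {α β : Type*} [MeasurableSpace α] [MeasurableSpace β]
    {f : β → ℝ} (hf : UniversallyMeasurable f) {g : α → β} (hg : Measurable g) :
    UniversallyMeasurable fun a => f (g a) := fun μ _ =>
  (hf (μ.map g)).comp_measurable hg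

/-- A supremum of a jointly measurable function over a standard Borel index, countable or
not, is universally measurable: its superlevel sets are projections of measurable sets. -/
theorem universallyMeasurable_iSup {Ω Y : Type*} [MeasurableSpace Ω] [MeasurableSpace Y]
    [StandardBorelSpace Y] [Nonempty Y] {F : Ω → Y → ℝ} (hF : Measurable (Function.uncurry F))
    (hbdd : ∀ ω, BddAbove (range (F ω))) : UniversallyMeasurable fun ω => ⨆ y, F ω y := by
  intro μ _
  have hIoi (a : ℝ) : NullMeasurableSet ((fun ω => ⨆ y, F ω y) ⁻¹' Ioi a) μ := by
    have hset : (fun ω => ⨆ y, F ω y) ⁻¹' Ioi a =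
        Prod.fst '' (Function.uncurry F ⁻¹' Ioi a) := by
      ext ω
      simp [lt_ciSup_iff (hbdd ω)]
    rw [hset]
    exact nullMeasurableSet_image_fst μ (hF measurableSet_Ioi)
  have hnull : NullMeasurable (fun ω => ⨆ y, F ω y) μ :=
    measurable_of_Ioi (α := ℝ) (δ := NullMeasurableSpace Ω μ) hIoi
  exact hnull.aemeasurable

end ECRM

/-! ### The bounded differences inequality -/

namespace ECRM

open ProbabilityTheory Function
open scoped NNReal

theorem UniversallyMeasurable.integral_prod {α β : Type*} [MeasurableSpace α] [MeasurableSpace β]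
    {f : α × β → ℝ} (hf : UniversallyMeasurable f) (ν : Measure β) [IsFiniteMeasure ν] :
    UniversallyMeasurable fun a => ∫ b, f (a, b) ∂ν := fun μ _ =>
  (AEStronglyMeasurable.integral_prod_right' (hf (μ.prod ν)).aestronglyMeasurable).aemeasurable

theorem UniversallyMeasurable.integrable {α : Type*} [MeasurableSpace α] {f : α → ℝ}
    (hf : UniversallyMeasurable f) {C : ℝ} (hC : ∀ a, |f a| ≤ C) (μ : Measure α)
    [IsFiniteMeasure μ] : Integrable f μ :=
  Integrable.of_bound (hf μ).aestronglyMeasurable C (.of_forall hC)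

/-- McDiarmid's inequality in sub-Gaussian form. The function is assumed universally measurable, so
that the sections and partial integrals in the induction on the number of variables stay in the
class. -/
theorem hasSubgaussianMGF_of_bounded_differences {Ω : Type*} [MeasurableSpace Ω] (P : Measure Ω)
    [IsProbabilityMeasure P] {n : ℕ} {f : (Fin n → Ω) → ℝ} (hf : UniversallyMeasurable f) {C : ℝ}
    (hC : ∀ S, |f S| ≤ C) {c : Fin n → ℝ≥0} (hc : ∀ S i z, |f (update S i z) - f S| ≤ c i) :
    HasSubgaussianMGF (fun S => f S - ∫ S, f S ∂Measure.pi fun _ => P) (∑ i, (c i / 2) ^ 2)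
      (Measure.pi fun _ => P) := by
  induction n with
  | zero =>
    have h0 : (fun S => f S - ∫ S, f S ∂Measure.pi fun _ => P) = fun _ => 0 := by
      funext S
      have : f = fun _ => f S := funext fun S' => by rw [Subsingleton.elim S' S]
      rw [this]
      simp
    rw [h0]
    simp
  | succ n ih =>
    set m := ∫ S, f S ∂Measure.pi fun _ => P with hm
    have hexp (t : ℝ) : Integrable (fun S => Real.exp (t * (f S - m))) (Measure.pi fun _ => P) :=
      integrable_exp_mul_of_mem_Icc (a := -C - m) (b := C - m) ((hf _).sub_const _)
        (.of_forall fun S => ⟨by linarith [(abs_le.1 (hC S)).1], by linarith [(abs_le.1 (hC S)).2]⟩)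
    refine ⟨hexp, fun t => ?_⟩
    let Q : Measure (Fin n → Ω) := Measure.pi fun _ => P
    let e := MeasurableEquiv.piFinSuccAbove (fun _ : Fin (n + 1) => Ω) 0
    have he : MeasurePreserving e.symm (P.prod Q) (Measure.pi fun _ => P) :=
      (measurePreserving_piFinSuccAbove (fun _ : Fin (n + 1) => P) 0).symm
    have hes (x : Ω) (ω : Fin n → Ω) : e.symm (x, ω) = Fin.cons x ω := by
      change Fin.insertNth (α := fun _ => Ω) 0 x ω = _
      simp
    have hF : UniversallyMeasurable fun p => f (e.symm p) := hf.comp e.symm.measurable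
    let g : Ω → ℝ := fun x => ∫ ω, f (e.symm (x, ω)) ∂Q
    have hg : UniversallyMeasurable g := hF.integral_prod Q
    have hFx (x : Ω) : UniversallyMeasurable fun ω => f (e.symm (x, ω)) :=
      hF.comp measurable_prodMk_left
    have hgm : ∫ x, g x ∂P = m := by
      rw [hm, ← he.integral_comp' f]
      exact (MeasureTheory.integral_prod _ (hF.integrable (fun p => hC _) _)).symm
    have hgC (x : Ω) : |g x| ≤ C := by
      have := norm_integral_le_of_norm_le_const (μ := Q) (f := fun ω => f (e.symm (x, ω)))
        (C := C) (.of_forall fun ω => hC _)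
      simpa [Real.norm_eq_abs] using this
    have hgdiff (x x' : Ω) : g x ≤ g x' + c 0 := by
      have h1 : ∫ ω, f (e.symm (x, ω)) ∂Q ≤ ∫ ω, (f (e.symm (x', ω)) + c 0) ∂Q := by
        refine integral_mono ((hFx x).integrable (fun _ => hC _) _)
          (((hFx x').integrable (fun _ => hC _) _).add (integrable_const _)) fun ω => ?_
        have := hc (e.symm (x', ω)) 0 x
        rw [hes, Fin.update_cons_zero, ← hes, ← hes] at this
        dsimp only
        linarith [(abs_le.1 this).2]
      rw [integral_add ((hFx x').integrable (fun _ => hC _) _) (integrable_const _)] at h1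
      simpa using h1
    have : Nonempty Ω := nonempty_of_isProbabilityMeasure P
    have hbdd : BddBelow (Set.range g) :=
      ⟨-C, by rintro _ ⟨x, rfl⟩; exact (abs_le.1 (hgC x)).1⟩
    -- The partial integral over the other coordinates has oscillation at most `c 0`, so Hoeffding's
    -- lemma applies to it.
    have hgsub : HasSubgaussianMGF (fun x => g x - m) ((c 0 / 2) ^ 2) P := by
      have := hasSubgaussianMGF_of_mem_Icc (μ := P) (X := g) (a := ⨅ x, g x)
        (b := (⨅ x, g x) + c 0) (hg P) (.of_forall fun x => ⟨ciInf_le hbdd x, by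
          rw [← sub_le_iff_le_add]
          exact le_ciInf fun x' => by linarith [hgdiff x x']⟩)
      rw [hgm] at this
      simpa using this
    -- Conditionally on the first coordinate, the induction hypothesis applies to the others.
    have hinner (x : Ω) : ∫ ω, Real.exp (t * (f (e.symm (x, ω)) - m)) ∂Q ≤
        Real.exp (t * (g x - m)) *
          Real.exp ((∑ i : Fin n, (c i.succ / 2) ^ 2 : ℝ≥0) * t ^ 2 / 2) := by
      have hx := (ih (hFx x) (fun _ => hC _) (c := fun i => c i.succ) (fun S i z => by
        have := hc (e.symm (x, S)) i.succ z
        rwa [hes, ← Fin.cons_update, ← hes, ← hes] at this)).mgf_le t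
      rw [mgf] at hx
      have hsplit (ω : Fin n → Ω) : Real.exp (t * (f (e.symm (x, ω)) - m)) =
          Real.exp (t * (g x - m)) * Real.exp (t * (f (e.symm (x, ω)) - g x)) := by
        rw [← Real.exp_add]; ring_nf
      simp_rw [hsplit]
      rw [integral_const_mul]
      exact mul_le_mul_of_nonneg_left hx (Real.exp_pos _).le
    have hprod : Integrable (fun p => Real.exp (t * (f (e.symm p) - m))) (P.prod Q) :=
      (he.integrable_comp_emb e.symm.measurableEmbedding).2 (hexp t)
    calc mgf (fun S => f S - m) (Measure.pi fun _ => P) t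
        = ∫ x, ∫ ω, Real.exp (t * (f (e.symm (x, ω)) - m)) ∂Q ∂P := by
          rw [mgf, ← he.integral_comp' (g := fun S => Real.exp (t * (f S - m)))]
          exact MeasureTheory.integral_prod _ hprod
      _ ≤ ∫ x, Real.exp (t * (g x - m)) *
            Real.exp ((∑ i : Fin n, (c i.succ / 2) ^ 2 : ℝ≥0) * t ^ 2 / 2) ∂P :=
          integral_mono hprod.integral_prod_left
            ((hgsub.integrable_exp_mul t).mul_const _) hinner
      _ ≤ Real.exp (((c 0 / 2) ^ 2 : ℝ≥0) * t ^ 2 / 2) *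
            Real.exp ((∑ i : Fin n, (c i.succ / 2) ^ 2 : ℝ≥0) * t ^ 2 / 2) := by
          rw [integral_mul_const]
          exact mul_le_mul_of_nonneg_right (hgsub.mgf_le t) (Real.exp_pos _).le
      _ = Real.exp ((∑ i, (c i / 2) ^ 2 : ℝ≥0) * t ^ 2 / 2) := by
          rw [← Real.exp_add, Fin.sum_univ_succ, NNReal.coe_add]
          ring_nf

/-- The one-sided tail bound of McDiarmid's inequality, with all differences at most `c / n`, as a
measurable event of probability at least `1 - δ`. -/
theorem exists_measurableSet_le_integral_add {Ω : Type*} [MeasurableSpace Ω] (P : Measure Ω)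
    [IsProbabilityMeasure P] {n : ℕ} (hn : 0 < n) {f : (Fin n → Ω) → ℝ}
    (hf : UniversallyMeasurable f) {C : ℝ} (hC : ∀ S, |f S| ≤ C) {c : ℝ} (hc0 : 0 < c)
    (hc : ∀ S i z, |f (update S i z) - f S| ≤ c / n) {δ : ℝ} (hδ0 : 0 < δ) (hδ1 : δ < 1) :
    ∃ E, MeasurableSet E ∧ ENNReal.ofReal (1 - δ) ≤ Measure.pi (fun _ : Fin n => P) E ∧
      ∀ S ∈ E, f S ≤ (∫ S, f S ∂Measure.pi fun _ => P) +
        c * Real.sqrt (Real.log (1 / δ) / (2 * n)) := by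
  set Q : Measure (Fin n → Ω) := Measure.pi fun _ => P
  have hn' : (0 : ℝ) < n := by exact_mod_cast hn
  set ε := c * Real.sqrt (Real.log (1 / δ) / (2 * n)) with hε
  have hlog : 0 ≤ Real.log (1 / δ) := Real.log_nonneg (by rw [le_div_iff₀ hδ0]; linarith)
  obtain ⟨d, hd⟩ : ∃ d : ℝ≥0, (d : ℝ) = c / n := ⟨⟨c / n, by positivity⟩, rfl⟩
  have hsub := hasSubgaussianMGF_of_bounded_differences P hf hC (c := fun _ => d)
    (by simpa only [hd] using hc)
  have hB := hsub.measure_ge_le (ε := ε) (by positivity)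
  set B := {S | ε ≤ f S - ∫ S, f S ∂Q}
  have hBδ : Q.real B ≤ δ := by
    refine hB.trans_eq ?_
    have hsq : ε ^ 2 = c ^ 2 * (Real.log (1 / δ) / (2 * n)) := by
      rw [hε, mul_pow, Real.sq_sqrt (by positivity)]
    have hexponent : -ε ^ 2 / (2 * ((∑ _i : Fin n, (d / 2) ^ 2 : ℝ≥0) : ℝ)) =
        Real.log δ := by
      rw [hsq, one_div, Real.log_inv]
      push_cast
      simp only [hd, Finset.sum_const, Finset.card_univ, Fintype.card_fin, nsmul_eq_mul]
      field_simp
    rw [hexponent, Real.exp_log hδ0]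
  -- The bad event is only null measurable, so its measurable hull is removed.
  refine ⟨(toMeasurable Q B)ᶜ, (measurableSet_toMeasurable _ _).compl, ?_, fun S hS => ?_⟩
  · rw [prob_compl_eq_one_sub (measurableSet_toMeasurable _ _), measure_toMeasurable,
      ENNReal.ofReal_sub _ hδ0.le, ENNReal.ofReal_one]
    refine tsub_le_tsub_left ?_ _
    exact (ENNReal.le_ofReal_iff_toReal_le (measure_ne_top _ _) hδ0.le).2 hBδ
  · have : S ∉ B := fun h => hS (subset_toMeasurable _ _ h)
    have : ¬ ε ≤ f S - ∫ S, f S ∂Q := this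
    linarith

/-- Replacing one point of an i.i.d. sample by a fresh one does not change its distribution. -/
theorem measurePreserving_update {Ω : Type*} [MeasurableSpace Ω] (P : Measure Ω)
    [IsProbabilityMeasure P] {n : ℕ} (i : Fin n) :
    MeasurePreserving (fun p : (Fin n → Ω) × Ω => update p.1 i p.2)
      ((Measure.pi fun _ => P).prod P) (Measure.pi fun _ => P) := by
  have hmeas : Measurable fun p : (Fin n → Ω) × Ω => update p.1 i p.2 := measurable_update'
  refine ⟨hmeas, (Measure.pi_eq fun s hs => ?_).symm⟩
  rw [Measure.map_apply hmeas (MeasurableSet.univ_pi hs)]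
  have hpre : (fun p : (Fin n → Ω) × Ω => update p.1 i p.2) ⁻¹' Set.univ.pi s =
      Set.univ.pi (update s i Set.univ) ×ˢ s i := by
    ext ⟨S, z⟩
    simp only [Set.mem_preimage, Set.mem_univ_pi, Set.mem_prod]
    constructor
    · refine fun h => ⟨fun j => ?_, by simpa using h i⟩
      rcases eq_or_ne j i with rfl | hj
      · simp
      · simpa [hj] using h j
    · rintro ⟨h1, h2⟩ j
      rcases eq_or_ne j i with rfl | hj
      · simpa using h2
      · simpa [hj] using h1 j
  rw [hpre, Measure.prod_prod, Measure.pi_pi,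
    ← Finset.mul_prod_erase Finset.univ (fun j => P (update s i Set.univ j)) (Finset.mem_univ i),
    ← Finset.mul_prod_erase Finset.univ (fun j => P (s j)) (Finset.mem_univ i), mul_comm]
  congr 1
  rw [update_self, measure_univ, one_mul]
  exact Finset.prod_congr rfl fun j hj => by rw [update_of_ne (Finset.ne_of_mem_erase hj)]

end ECRM

/-! ### Generalization from uniform stability -/

namespace ECRM

open Function

/-- Let `T S z` be the loss at `z` of what was learned from `S`. If it takes values in `[0, L]` and
moves by at most `β` when one point of `S` is replaced, then with high probability the population
mean of `T S` exceeds its mean over the sample `S` itself by little. -/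
theorem exists_generalization_bound_of_uniform_stability {Z : Type*} [MeasurableSpace Z]
    (P : Measure Z) [IsProbabilityMeasure P] {m : ℕ} (hm : 0 < m) {T : (Fin m → Z) → Z → ℝ}
    (hT : UniversallyMeasurable (uncurry T)) {L β : ℝ} (hL : 0 < L) (hβ : 0 ≤ β)
    (hT0 : ∀ S z, 0 ≤ T S z) (hTL : ∀ S z, T S z ≤ L)
    (hstab : ∀ S i z' z, |T (update S i z') z - T S z| ≤ β) {δ : ℝ} (hδ0 : 0 < δ) (hδ1 : δ < 1) :
    ∃ E, MeasurableSet E ∧ ENNReal.ofReal (1 - δ) ≤ Measure.pi (fun _ : Fin m => P) E ∧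
      ∀ S ∈ E, ∫ z, T S z ∂P ≤ (1 / (m : ℝ)) * ∑ i, T S (S i) + β +
        (2 * m * β + L) * Real.sqrt (Real.log (1 / δ) / (2 * m)) := by
  have hm' : (0 : ℝ) < m := by exact_mod_cast hm
  set Q : Measure (Fin m → Z) := Measure.pi fun _ => P with hQ
  have hTabs (S z) : |T S z| ≤ L := abs_le.2 ⟨by linarith [hT0 S z], hTL S z⟩
  have hTS (S) : UniversallyMeasurable (T S) := hT.comp (measurable_prodMk_left (x := S))
  have hTi (i : Fin m) : UniversallyMeasurable fun S => T S (S i) :=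
    hT.comp (measurable_id.prodMk (measurable_pi_apply i))
  have hpop : UniversallyMeasurable fun S => ∫ z, T S z ∂P := hT.integral_prod P
  have hTint (S) : Integrable (T S) P := (hTS S).integrable (hTabs S) P
  have hTiint (i : Fin m) : Integrable (fun S => T S (S i)) Q :=
    (hTi i).integrable (fun S => hTabs _ _) Q
  have hTint2 : Integrable (uncurry T) (Q.prod P) := hT.integrable (fun p => hTabs _ _) _
  let f : (Fin m → Z) → ℝ := fun S => ∫ z, T S z ∂P - (1 / (m : ℝ)) * ∑ i, T S (S i)
  have hf : UniversallyMeasurable f := fun ν _ =>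
    (hpop ν).sub ((Finset.aemeasurable_fun_sum _ fun i _ => hTi i ν).const_mul _)
  have hpop0 (S) : 0 ≤ ∫ z, T S z ∂P := integral_nonneg (hT0 S)
  have hpopL (S) : ∫ z, T S z ∂P ≤ L := by
    simpa using integral_mono (hTint S) (integrable_const L) (hTL S)
  have hemp0 (S) : 0 ≤ (1 / (m : ℝ)) * ∑ i, T S (S i) :=
    mul_nonneg (by positivity) (Finset.sum_nonneg fun i _ => hT0 _ _)
  have hempL (S) : (1 / (m : ℝ)) * ∑ i, T S (S i) ≤ L := by
    have : ∑ i, T S (S i) ≤ m * L := by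
      simpa using Finset.sum_le_sum fun i (_ : i ∈ Finset.univ) => hTL S (S i)
    rw [one_div, inv_mul_le_iff₀ hm']
    exact this
  have hfC (S) : |f S| ≤ L :=
    abs_le.2 ⟨by dsimp only [f]; linarith [hpop0 S, hempL S], by
      dsimp only [f]; linarith [hpopL S, hemp0 S]⟩
  have hpopdiff (S i z') : |(∫ z, T (update S i z') z ∂P) - ∫ z, T S z ∂P| ≤ β := by
    rw [← integral_sub (hTint _) (hTint _)]
    simpa using norm_integral_le_of_norm_le_const (μ := P) (C := β)
      (f := fun z => T (update S i z') z - T S z) (.of_forall fun z => hstab S i z' z)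
  have hempdiff (S : Fin m → Z) (i z') :
      |(∑ j, T (update S i z') (update S i z' j)) - ∑ j, T S (S j)| ≤ m * β + L := by
    rw [← Finset.sum_sub_distrib]
    refine (Finset.abs_sum_le_sum_abs _ _).trans ?_
    -- Only the replaced point contributes more than `β`: there the two losses are evaluated at
    -- different points, and only their range `[0, L]` is of use.
    have hterm (j : Fin m) : |T (update S i z') (update S i z' j) - T S (S j)| ≤
        β + if j = i then L else 0 := by
      split_ifs with hj
      · have h1 := hT0 (update S i z') (update S i z' j)
        have h2 := hTL (update S i z') (update S i z' j)
        exact abs_le.2 ⟨by linarith [hTL S (S j)], by linarith [hT0 S (S j)]⟩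
      · rw [update_of_ne hj, add_zero]
        exact hstab _ _ _ _
    refine (Finset.sum_le_sum fun j _ => hterm j).trans_eq ?_
    simp [Finset.sum_add_distrib]
  have hfdiff (S i z') : |f (update S i z') - f S| ≤ (2 * m * β + L) / m := by
    have h1 := hpopdiff S i z'
    have h2 : |(1 / (m : ℝ)) * ((∑ j, T (update S i z') (update S i z' j)) - ∑ j, T S (S j))| ≤
        (1 / (m : ℝ)) * (m * β + L) := by
      rw [abs_mul, abs_of_pos (show (0 : ℝ) < 1 / m by positivity)]
      exact mul_le_mul_of_nonneg_left (hempdiff S i z') (by positivity)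
    have h3 : f (update S i z') - f S = ((∫ z, T (update S i z') z ∂P) - ∫ z, T S z ∂P) -
        (1 / (m : ℝ)) * ((∑ j, T (update S i z') (update S i z' j)) - ∑ j, T S (S j)) := by
      dsimp only [f]; ring
    rw [h3]
    refine (abs_sub _ _).trans ((add_le_add h1 h2).trans_eq ?_)
    field_simp
    ring
  have hmean : ∫ S, f S ∂Q ≤ β := by
    have hi (i : Fin m) : ∫ p, uncurry T p ∂(Q.prod P) - β ≤ ∫ S, T S (S i) ∂Q := by
      have hup := measurePreserving_update P i
      have heq : ∫ S, T S (S i) ∂Q =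
          ∫ p : (Fin m → Z) × Z, T (update p.1 i p.2) p.2 ∂(Q.prod P) := by
        conv_lhs => rw [hQ, ← hup.map_eq]
        rw [integral_map hup.measurable.aemeasurable (hTi i _).aestronglyMeasurable]
        simp [hQ]
      have hint : Integrable (fun p : (Fin m → Z) × Z => T (update p.1 i p.2) p.2) (Q.prod P) :=
        (hT.comp (hup.measurable.prodMk measurable_snd)).integrable (fun p => hTabs _ _) _
      have hle : ∫ p, (uncurry T p - β) ∂(Q.prod P) ≤
          ∫ p : (Fin m → Z) × Z, T (update p.1 i p.2) p.2 ∂(Q.prod P) :=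
        integral_mono (hTint2.sub (integrable_const β)) hint fun p => by
          have := (abs_le.1 (hstab p.1 i p.2 p.2)).1
          simp only [uncurry]
          linarith
      rw [heq]
      rw [integral_sub hTint2 (integrable_const β)] at hle
      simpa using hle
    have hpopint : Integrable (fun S => ∫ z, T S z ∂P) Q :=
      hpop.integrable (C := L) (fun S => abs_le.2 ⟨by linarith [hpop0 S], hpopL S⟩) Q
    have hsplit : ∫ S, f S ∂Q = ∫ p, uncurry T p ∂(Q.prod P) -
        (1 / (m : ℝ)) * ∑ i, ∫ S, T S (S i) ∂Q := by
      dsimp only [f]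
      rw [integral_sub hpopint ((integrable_finsetSum _ fun i _ => hTiint i).const_mul _),
        integral_const_mul, integral_finsetSum _ fun i _ => hTiint i,
        MeasureTheory.integral_prod _ hTint2]
      rfl
    have hsum := Finset.sum_le_sum fun i (_ : i ∈ Finset.univ) => hi i
    simp only [Finset.sum_const, Finset.card_univ, Fintype.card_fin, nsmul_eq_mul] at hsum
    have hsum' : ∫ p, uncurry T p ∂(Q.prod P) - β ≤ (1 / (m : ℝ)) * ∑ i, ∫ S, T S (S i) ∂Q := by
      rw [one_div, le_inv_mul_iff₀ hm']
      exact hsum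
    rw [hsplit]
    linarith
  obtain ⟨E, hE, hEδ, hbound⟩ := exists_measurableSet_le_integral_add P hm hf hfC
    (c := 2 * m * β + L) (by positivity) hfdiff hδ0 hδ1
  refine ⟨E, hE, hEδ, fun S hS => ?_⟩
  have h := hbound S hS
  dsimp only [f] at h hmean
  linarith

end ECRM

/-! ### Kernel ridge regression -/

namespace ECRM

open Function
open scoped InnerProductSpace

section Ridge

variable {X Y H : Type*} {m : ℕ} [NormedAddCommGroup H] [InnerProductSpace ℝ H] [RKHS ℝ H X ℝ]
  {ℓ : Y → Y → ℝ} {lam L κ : ℝ} {S : Fin m → X × Y} {R : Y → H} {k : X → X → ℝ}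

/-- The normal equation of ridge regression in weak form: the first variation of the objective at
its minimizer vanishes in every direction. -/
theorem IsRiskEstimate.normal_equation (hR : IsRiskEstimate ℓ lam S R) (y : Y) (d : H) :
    (1 / (m : ℝ)) * ∑ i, (R y (S i).1 - ℓ y (S i).2) * d (S i).1 + lam * ⟪R y, d⟫_ℝ = 0 := by
  set A := (1 / (m : ℝ)) * ∑ i, (R y (S i).1 - ℓ y (S i).2) * d (S i).1 + lam * ⟪R y, d⟫_ℝ with hA
  set B := (1 / (m : ℝ)) * ∑ i, d (S i).1 ^ 2 + lam * ‖d‖ ^ 2 with hB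
  have hexpand (t : ℝ) : ridgeObjective ℓ lam S y (R y + t • d) =
      ridgeObjective ℓ lam S y (R y) + (B * (t * t) + 2 * A * t) := by
    have hsum : ∑ i, ((R y + t • d) (S i).1 - ℓ y (S i).2) ^ 2 =
        ∑ i, (R y (S i).1 - ℓ y (S i).2) ^ 2 +
          2 * t * ∑ i, (R y (S i).1 - ℓ y (S i).2) * d (S i).1 + t * t * ∑ i, d (S i).1 ^ 2 := by
      rw [Finset.mul_sum, Finset.mul_sum, ← Finset.sum_add_distrib, ← Finset.sum_add_distrib]
      refine Finset.sum_congr rfl fun i _ => ?_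
      simp only [RKHS.coe_add, RKHS.coe_smul, Pi.add_apply, Pi.smul_apply, smul_eq_mul]
      ring
    have hnorm : ‖R y + t • d‖ ^ 2 = ‖R y‖ ^ 2 + 2 * t * ⟪R y, d⟫_ℝ + t * t * ‖d‖ ^ 2 := by
      rw [norm_add_sq_real, inner_smul_right, norm_smul, mul_pow, Real.norm_eq_abs, sq_abs]
      ring
    rw [ridgeObjective, ridgeObjective, hsum, hnorm, hA, hB]
    ring
  -- A quadratic without constant term is nonnegative only if its linear coefficient vanishes.
  have hdisc := discrim_le_zero (a := B) (b := 2 * A) (c := 0) fun t => by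
    have := hR y (R y + t • d)
    rw [hexpand] at this
    linarith
  rw [discrim] at hdisc
  nlinarith [sq_nonneg A]

/-- The a priori bound obtained by comparing the minimizer with `0`. -/
theorem IsRiskEstimate.norm_sq_le (hR : IsRiskEstimate ℓ lam S R) (hm : 0 < m)
    (hℓ0 : ∀ y y', 0 ≤ ℓ y y') (hℓL : ∀ y y', ℓ y y' ≤ L) (y : Y) : lam * ‖R y‖ ^ 2 ≤ L ^ 2 := by
  have hm' : (0 : ℝ) < m := by exact_mod_cast hm
  have h0 := hR y 0
  have h1 : (1 / (m : ℝ)) * ∑ i, (ℓ y (S i).2) ^ 2 ≤ L ^ 2 := by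
    rw [one_div, inv_mul_le_iff₀ hm']
    simpa using Finset.sum_le_sum fun i (_ : i ∈ Finset.univ) =>
      pow_le_pow_left₀ (hℓ0 y (S i).2) (hℓL y (S i).2) 2
  have h2 : 0 ≤ (1 / (m : ℝ)) * ∑ i, (R y (S i).1 - ℓ y (S i).2) ^ 2 := by positivity
  simp only [ridgeObjective, RKHS.coe_zero, Pi.zero_apply, zero_sub, neg_sq, norm_zero] at h0
  linarith

variable [CompleteSpace H]

theorem inner_kerFun_one (x : X) (f : H) : ⟪RKHS.kerFun H x (1 : ℝ), f⟫_ℝ = f x := by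
  rw [RKHS.kerFun_inner]
  simp

/-- Evaluation at a point has norm at most `√κ`. -/
theorem abs_apply_le (hkH : ∀ x x', RKHS.kernel H x x' 1 = k x x') (hκ : ∀ x, k x x ≤ κ)
    (f : H) (x : X) : |f x| ≤ √κ * ‖f‖ := by
  have hsq : ‖RKHS.kerFun H x (1 : ℝ)‖ ^ 2 = k x x := by
    rw [← real_inner_self_eq_norm_sq, inner_kerFun_one, RKHS.kerFun_apply, hkH]
  rw [← inner_kerFun_one x f]
  refine (abs_real_inner_le_norm _ _).trans (mul_le_mul_of_nonneg_right ?_ (norm_nonneg _))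
  exact Real.le_sqrt_of_sq_le (hsq.trans_le (hκ x))

theorem IsRiskEstimate.abs_apply_le (hR : IsRiskEstimate ℓ lam S R) (hm : 0 < m) (hlam : 0 < lam)
    (hℓ0 : ∀ y y', 0 ≤ ℓ y y') (hℓL : ∀ y y', ℓ y y' ≤ L)
    (hkH : ∀ x x', RKHS.kernel H x x' 1 = k x x') (hκ : ∀ x, k x x ≤ κ) (y : Y) (x : X) :
    |R y x| ≤ L * √(κ / lam) := by
  have hL : 0 ≤ L := (hℓ0 y y).trans (hℓL y y)
  have hnorm : √lam * ‖R y‖ ≤ L := by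
    refine le_of_sq_le_sq ?_ hL
    rw [mul_pow, Real.sq_sqrt hlam.le]
    exact hR.norm_sq_le hm hℓ0 hℓL y
  have hs : 0 < √lam := Real.sqrt_pos.2 hlam
  rw [Real.sqrt_div' _ hlam.le, mul_div_assoc', le_div_iff₀ hs]
  calc |R y x| * √lam ≤ √κ * ‖R y‖ * √lam :=
        mul_le_mul_of_nonneg_right (ECRM.abs_apply_le hkH hκ _ _) hs.le
    _ = √κ * (√lam * ‖R y‖) := by ring
    _ ≤ √κ * L := mul_le_mul_of_nonneg_left hnorm (Real.sqrt_nonneg _)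
    _ = L * √κ := mul_comm _ _

/-- Uniform stability of kernel ridge regression under replacement of one training point.
Subtracting the normal equations, both tested against the difference `d`, leaves `lam * ‖d‖ ^ 2`
plus nonnegative squares on one side and only the terms of the replaced point on the other. -/
theorem IsRiskEstimate.abs_sub_update_le {j : Fin m} {z : X × Y} {R' : Y → H}
    (hR : IsRiskEstimate ℓ lam S R) (hR' : IsRiskEstimate ℓ lam (update S j z) R')
    (hm : 0 < m) (hlam : 0 < lam)
    (hℓ0 : ∀ y y', 0 ≤ ℓ y y') (hℓL : ∀ y y', ℓ y y' ≤ L)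
    (hkH : ∀ x x', RKHS.kernel H x x' 1 = k x x') (hκ0 : 0 ≤ κ) (hκ : ∀ x, k x x ≤ κ)
    (y : Y) (x : X) :
    |R' y x - R y x| ≤ 2 * L * (κ / lam + (κ / lam) ^ (3 / 2 : ℝ)) / m := by
  have hm' : (0 : ℝ) < m := by exact_mod_cast hm
  set d := R' y - R y with hd
  have hdx (x : X) : d x = R' y x - R y x := by rw [hd, RKHS.coe_sub, Pi.sub_apply]
  have e := hR.normal_equation y d
  have e' := hR'.normal_equation y d
  set b := L * (1 + √(κ / lam)) with hb
  have hres (x : X) (y' : Y) : |R y x - ℓ y y'| ≤ b := by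
    have h1 := abs_le.1 (hR.abs_apply_le hm hlam hℓ0 hℓL hkH hκ y x)
    rw [hb, mul_add, mul_one]
    exact abs_le.2 ⟨by linarith [hℓL y y'], by linarith [hℓ0 y y', (hℓ0 y y').trans (hℓL y y')]⟩
  have hprod (x : X) (y' : Y) : |(R y x - ℓ y y') * d x| ≤ b * (√κ * ‖d‖) := by
    rw [abs_mul]
    exact mul_le_mul (hres x y') (ECRM.abs_apply_le hkH hκ d x) (abs_nonneg _)
      ((abs_nonneg _).trans (hres x y'))
  -- At the points common to both samples the residuals differ by `d`, which leaves a square.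
  have hterm (i : Fin m) : -(if i = j then 2 * (b * (√κ * ‖d‖)) else 0) ≤
      (R' y (update S j z i).1 - ℓ y (update S j z i).2) * d (update S j z i).1 -
        (R y (S i).1 - ℓ y (S i).2) * d (S i).1 := by
    split_ifs with hi
    · have h1 := abs_le.1 (hprod (update S j z i).1 (update S j z i).2)
      have h2 := abs_le.1 (hprod (S i).1 (S i).2)
      have h3 := sq_nonneg (d (update S j z i).1)
      have h4 := hdx (update S j z i).1
      have h5 : R' y (update S j z i).1 = R y (update S j z i).1 + d (update S j z i).1 := by
        linarith
      rw [h5]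
      nlinarith
    · rw [update_of_ne hi]
      have h3 := sq_nonneg (d (S i).1)
      have h5 : R' y (S i).1 = R y (S i).1 + d (S i).1 := by linarith [hdx (S i).1]
      rw [h5]
      nlinarith
  have hsum := Finset.sum_le_sum fun i (_ : i ∈ Finset.univ) => hterm i
  rw [Finset.sum_sub_distrib, Finset.sum_neg_distrib, Finset.sum_ite_eq' Finset.univ j,
    if_pos (Finset.mem_univ j)] at hsum
  have hdd : ⟪R' y, d⟫_ℝ - ⟪R y, d⟫_ℝ = ‖d‖ ^ 2 := by
    rw [← inner_sub_left, ← hd, real_inner_self_eq_norm_sq]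
  have hmain : lam * ‖d‖ ^ 2 ≤ (1 / (m : ℝ)) * (2 * (b * (√κ * ‖d‖))) := by
    have := mul_le_mul_of_nonneg_left hsum (show (0 : ℝ) ≤ 1 / m by positivity)
    rw [mul_sub] at this
    rw [← hdd]
    linarith
  have hdnorm : lam * ‖d‖ ≤ (1 / (m : ℝ)) * (2 * (b * √κ)) := by
    rcases (norm_nonneg d).eq_or_lt with h0 | hpos
    · rw [← h0, mul_zero]
      have : 0 ≤ b := (abs_nonneg _).trans (hres x y)
      positivity
    · refine le_of_mul_le_mul_right ?_ hpos
      linarith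
  have hpow : (κ / lam) ^ (3 / 2 : ℝ) = κ / lam * √(κ / lam) := by
    have hq : 0 ≤ κ / lam := by positivity
    rw [Real.sqrt_eq_rpow, show (3 / 2 : ℝ) = 1 + 1 / 2 by norm_num,
      Real.rpow_add_of_nonneg hq (by norm_num) (by norm_num), Real.rpow_one]
  rw [← hdx]
  refine (ECRM.abs_apply_le hkH hκ d x).trans ?_
  calc √κ * ‖d‖ = √κ * (lam * ‖d‖) / lam := by field_simp
    _ ≤ √κ * ((1 / (m : ℝ)) * (2 * (b * √κ))) / lam :=
        div_le_div_of_nonneg_right (mul_le_mul_of_nonneg_left hdnorm (Real.sqrt_nonneg _)) hlam.le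
    _ = (√κ * √κ) * ((1 / (m : ℝ)) * (2 * b)) / lam := by ring
    _ = 2 * L * (κ / lam + (κ / lam) ^ (3 / 2 : ℝ)) / m := by
        rw [Real.mul_self_sqrt hκ0, hpow, hb]
        field_simp

/-- The regularized kernel matrix `K + m λ I`, `K i j = k (x i) (x j)`, of the sample `S`. -/
def regularizedKernelMatrix (k : X → X → ℝ) (lam : ℝ) (S : Fin m → X × Y) :
    Matrix (Fin m) (Fin m) ℝ :=
  Matrix.of (fun i j => k (S i).1 (S j).1) + (m * lam) • 1

theorem isUnit_regularizedKernelMatrix (hkH : ∀ x x', RKHS.kernel H x x' 1 = k x x') (hm : 0 < m)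
    (hlam : 0 < lam) (S : Fin m → X × Y) : IsUnit (regularizedKernelMatrix k lam S) := by
  have hm' : (0 : ℝ) < m := by exact_mod_cast hm
  have hgram : Matrix.of (fun i j => k (S i).1 (S j).1) =
      Matrix.gram ℝ fun i => RKHS.kerFun H (S i).1 (1 : ℝ) := by
    ext i j
    rw [Matrix.gram_apply, inner_kerFun_one, RKHS.kerFun_apply, hkH, Matrix.of_apply]
  rw [regularizedKernelMatrix, hgram]
  exact (Matrix.PosDef.posSemidef_add (Matrix.posSemidef_gram ℝ _)
    (Matrix.PosDef.one.smul (by positivity))).isUnit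

/-- The representer theorem with explicit coefficients `(K + m λ I)⁻¹ ℓ(y, ·)`. -/
theorem IsRiskEstimate.apply_eq (hR : IsRiskEstimate ℓ lam S R) (hm : 0 < m) (hlam : 0 < lam)
    (hkH : ∀ x x', RKHS.kernel H x x' 1 = k x x') (y : Y) (x : X) :
    R y x = ∑ i, ((regularizedKernelMatrix k lam S)⁻¹.mulVec fun j => ℓ y (S j).2) i *
      k x (S i).1 := by
  have hm' : (0 : ℝ) < m := by exact_mod_cast hm
  -- The normal equation, tested against kernel sections, exhibits `R y` as the combination of
  -- kernel sections with these coefficients.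
  let a : Fin m → ℝ := fun i => (ℓ y (S i).2 - R y (S i).1) / (m * lam)
  have hker (x' : X) : R y x' = ∑ i, a i * k x' (S i).1 := by
    have e := hR.normal_equation y (RKHS.kerFun H x' (1 : ℝ))
    rw [real_inner_comm, inner_kerFun_one] at e
    have hsymm (i : Fin m) : RKHS.kerFun H x' (1 : ℝ) (S i).1 = k x' (S i).1 := by
      rw [← inner_kerFun_one, real_inner_comm, inner_kerFun_one, RKHS.kerFun_apply, hkH]
    simp only [hsymm] at e
    have hneg : ∑ i, a i * k x' (S i).1 = -((1 / (m * lam)) *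
        ∑ i, (R y (S i).1 - ℓ y (S i).2) * k x' (S i).1) := by
      rw [Finset.mul_sum, ← Finset.sum_neg_distrib]
      refine Finset.sum_congr rfl fun i _ => ?_
      dsimp only [a]
      ring
    rw [hneg]
    field_simp at e ⊢
    linarith
  have hsys : (regularizedKernelMatrix k lam S).mulVec a = fun j => ℓ y (S j).2 := by
    funext j
    rw [regularizedKernelMatrix, Matrix.add_mulVec, Pi.add_apply, Matrix.smul_mulVec,
      Matrix.one_mulVec, Pi.smul_apply, smul_eq_mul]
    have h1 : (Matrix.of fun i j => k (S i).1 (S j).1).mulVec a j = R y (S j).1 := by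
      rw [hker]
      simp only [Matrix.mulVec, dotProduct, Matrix.of_apply]
      exact Finset.sum_congr rfl fun i _ => mul_comm _ _
    rw [h1]
    dsimp only [a]
    field_simp
    ring
  have hdet : IsUnit (regularizedKernelMatrix k lam S).det :=
    (Matrix.isUnit_iff_isUnit_det _).1 (isUnit_regularizedKernelMatrix hkH hm hlam S)
  rw [← hsys, Matrix.mulVec_mulVec, Matrix.nonsing_inv_mul _ hdet, Matrix.one_mulVec]
  exact hker x

end Ridge

theorem measurable_det {Ω : Type*} [MeasurableSpace Ω] {m : ℕ} {A : Ω → Matrix (Fin m) (Fin m) ℝ}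
    (hA : ∀ i j, Measurable fun ω => A ω i j) : Measurable fun ω => (A ω).det := by
  simp only [Matrix.det_apply]
  exact Finset.measurable_fun_sum _ fun σ _ =>
    (Finset.measurable_fun_prod _ fun i _ => hA _ _).const_smul _

theorem measurable_inv_apply {Ω : Type*} [MeasurableSpace Ω] {m : ℕ}
    {A : Ω → Matrix (Fin m) (Fin m) ℝ} (hA : ∀ i j, Measurable fun ω => A ω i j) (i j : Fin m) :
    Measurable fun ω => (A ω)⁻¹ i j := by
  simp only [Matrix.inv_def, Matrix.smul_apply, Matrix.adjugate_apply, Ring.inverse_eq_inv',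
    smul_eq_mul]
  refine (measurable_det hA).inv.mul (measurable_det fun i' j' => ?_)
  rcases eq_or_ne i' j with rfl | h
  · simp
  · simpa [Matrix.updateRow_ne h] using hA i' j'

theorem measurable_riskEstimate {X Y H : Type*} [MeasurableSpace X] [MeasurableSpace Y] {m : ℕ}
    [NormedAddCommGroup H] [InnerProductSpace ℝ H] [CompleteSpace H] [RKHS ℝ H X ℝ]
    {ℓ : Y → Y → ℝ} {lam : ℝ} {k : X → X → ℝ} {R : (Fin m → X × Y) → Y → H}
    (hR : ∀ S, IsRiskEstimate ℓ lam S (R S)) (hm : 0 < m) (hlam : 0 < lam)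
    (hℓ : Measurable (uncurry ℓ)) (hk : Measurable (uncurry k))
    (hkH : ∀ x x', RKHS.kernel H x x' 1 = k x x') :
    Measurable fun p : (Fin m → X × Y) × Y × X => R p.1 p.2.1 p.2.2 := by
  simp only [fun S => (hR S).apply_eq hm hlam hkH, Matrix.mulVec, dotProduct]
  have hS (i : Fin m) : Measurable fun p : (Fin m → X × Y) × Y × X => p.1 i :=
    (measurable_pi_apply i).comp measurable_fst
  refine Finset.measurable_fun_sum _ fun i _ => Measurable.mul
    (Finset.measurable_fun_sum _ fun j _ => Measurable.mul ?_ ?_) ?_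
  · refine measurable_inv_apply (fun a b => ?_) i j
    simp only [regularizedKernelMatrix, Matrix.add_apply, Matrix.of_apply]
    exact (hk.comp ((hS a).fst.prodMk (hS b).fst)).add_const _
  · exact hℓ.comp (measurable_snd.fst.prodMk (hS j).snd)
  · exact hk.comp (measurable_snd.snd.prodMk (hS i).fst)

end ECRM

/-! ### The surrogate loss -/

namespace ECRM

open Function

section Surrogate

variable {X Y : Type*} {ℓ : Y → Y → ℝ} {L ρ : ℝ} {R R' : Y → X → ℝ} {x : X}

theorem bddBelow_of_forall_le {y₀ : Y} (h₀ : ∀ y', R y₀ x ≤ R y' x) :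
    BddBelow (Set.range fun y' => R y' x) :=
  ⟨R y₀ x, by rintro _ ⟨y', rfl⟩; exact h₀ y'⟩

theorem bddAbove_surrogate (hρ : 0 < ρ) (hℓL : ∀ y y', ℓ y y' ≤ L)
    (hbdd : BddBelow (Set.range fun y' => R y' x)) (y : Y) :
    BddAbove (Set.range fun y' => ℓ y' y + (1 / ρ) * gap R y' x) := by
  refine ⟨L, ?_⟩
  rintro _ ⟨y', rfl⟩
  have hgap : gap R y' x ≤ 0 := sub_nonpos.2 (ciInf_le hbdd y')
  have := mul_nonpos_of_nonneg_of_nonpos (one_div_pos.2 hρ).le hgap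
  dsimp only
  linarith [hℓL y' y]

/-- The surrogate loss dominates the loss of any minimizing label, as the gap vanishes there. -/
theorem le_surrogateLoss_of_minimizer (hρ : 0 < ρ) (hℓL : ∀ y y', ℓ y y' ≤ L) {y₀ : Y}
    (h₀ : ∀ y', R y₀ x ≤ R y' x) (y : Y) : ℓ y₀ y ≤ surrogateLoss ℓ L ρ R x y := by
  have hbdd := bddBelow_of_forall_le h₀
  have : Nonempty Y := ⟨y⟩
  have hgap : gap R y₀ x = 0 :=
    sub_eq_zero.2 (le_antisymm (ciInf_le hbdd y₀) (le_ciInf h₀))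
  refine le_min ?_ (hℓL _ _)
  simpa [hgap] using le_ciSup (bddAbove_surrogate hρ hℓL hbdd y) y₀

theorem surrogateLoss_le_add (hρ : 0 < ρ) (hℓL : ∀ y y', ℓ y y' ≤ L) {β : ℝ} (hβ : 0 ≤ β)
    (hbdd : BddBelow (Set.range fun y' => R y' x)) (hbdd' : BddBelow (Set.range fun y' => R' y' x))
    (hRR' : ∀ y, |R y x - R' y x| ≤ β) (y : Y) :
    surrogateLoss ℓ L ρ R x y ≤ surrogateLoss ℓ L ρ R' x y + 2 * β / ρ := by
  have : Nonempty Y := ⟨y⟩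
  have hinf : (⨅ y', R y' x) ≤ (⨅ y', R' y' x) + β := by
    rw [← sub_le_iff_le_add]
    refine le_ciInf fun y' => ?_
    linarith [ciInf_le hbdd y', (abs_le.1 (hRR' y')).2]
  have hgap (y' : Y) : gap R y' x ≤ gap R' y' x + 2 * β := by
    rw [gap, gap]
    linarith [(abs_le.1 (hRR' y')).1]
  have hsup : (⨆ y', (ℓ y' y + (1 / ρ) * gap R y' x)) ≤
      (⨆ y', (ℓ y' y + (1 / ρ) * gap R' y' x)) + 2 * β / ρ := by
    refine ciSup_le fun y' => ?_
    have h1 := le_ciSup (bddAbove_surrogate hρ hℓL hbdd' y) y'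
    have h2 := mul_le_mul_of_nonneg_left (hgap y') (one_div_pos.2 hρ).le
    have h3 : 1 / ρ * (gap R' y' x + 2 * β) = 1 / ρ * gap R' y' x + 2 * β / ρ := by ring
    linarith
  have hpos : 0 ≤ 2 * β / ρ := by positivity
  rw [surrogateLoss, surrogateLoss, ← min_add_add_right]
  exact min_le_min hsup (by linarith)

theorem abs_surrogateLoss_sub_le (hρ : 0 < ρ) (hℓL : ∀ y y', ℓ y y' ≤ L) {β : ℝ}
    (hbdd : BddBelow (Set.range fun y' => R y' x)) (hbdd' : BddBelow (Set.range fun y' => R' y' x))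
    (hRR' : ∀ y, |R y x - R' y x| ≤ β) (y : Y) :
    |surrogateLoss ℓ L ρ R x y - surrogateLoss ℓ L ρ R' x y| ≤ 2 * β / ρ := by
  have hβ : 0 ≤ β := (abs_nonneg _).trans (hRR' y)
  rw [abs_sub_le_iff, sub_le_iff_le_add', sub_le_iff_le_add']
  exact ⟨surrogateLoss_le_add hρ hℓL hβ hbdd hbdd' hRR' y,
    surrogateLoss_le_add hρ hℓL hβ hbdd' hbdd (fun y' => by rw [abs_sub_comm]; exact hRR' y') y⟩

/-- The infimum in the gap does not depend on the label over which the supremum runs, so the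
surrogate loss is assembled from one supremum and one infimum of jointly measurable functions. -/
theorem universallyMeasurable_surrogateLoss {Ω : Type*} [MeasurableSpace Ω] [MeasurableSpace X]
    [MeasurableSpace Y] [StandardBorelSpace Y] (hℓ : Measurable (uncurry ℓ)) (hρ : 0 < ρ)
    (hℓL : ∀ y y', ℓ y y' ≤ L) {r : Ω → Y → X → ℝ}
    (hr : Measurable fun p : Ω × Y × X => r p.1 p.2.1 p.2.2)
    (hbdd : ∀ ω x, BddBelow (Set.range fun y' => r ω y' x)) :
    UniversallyMeasurable fun p : Ω × X × Y => surrogateLoss ℓ L ρ (r p.1) p.2.1 p.2.2 := by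
  rcases isEmpty_or_nonempty Y with hY | hY
  · have : IsEmpty (Ω × X × Y) := ⟨fun p => hY.elim p.2.2⟩
    exact fun μ _ => Subsingleton.measurable.aemeasurable
  have hr' : Measurable fun q : (Ω × X × Y) × Y => r q.1.1 q.2 q.1.2.1 :=
    hr.comp (measurable_fst.fst.prodMk (measurable_snd.prodMk measurable_fst.snd.fst))
  have hinf : UniversallyMeasurable fun p : Ω × X × Y => ⨅ y', r p.1 y' p.2.1 := by
    have hneg := universallyMeasurable_iSup (F := fun (p : Ω × X × Y) y' => -r p.1 y' p.2.1) hr'.neg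
      fun p => by
        obtain ⟨a, ha⟩ := hbdd p.1 p.2.1
        exact ⟨-a, by rintro _ ⟨y', rfl⟩; exact neg_le_neg (ha ⟨y', rfl⟩)⟩
    intro μ _
    refine (hneg μ).neg.congr (.of_forall fun p => ?_)
    change -sSup (Set.range (-fun y' => r p.1 y' p.2.1)) = sInf (Set.range fun y' => r p.1 y' p.2.1)
    rw [Real.sInf_def, ← Set.image_neg_eq_neg, ← Set.range_comp]
    rfl
  have hbddF (p : Ω × X × Y) :
      BddAbove (Set.range fun y' => ℓ y' p.2.2 - (1 / ρ) * r p.1 y' p.2.1) := by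
    obtain ⟨a, ha⟩ := hbdd p.1 p.2.1
    refine ⟨L - (1 / ρ) * a, ?_⟩
    rintro _ ⟨y', rfl⟩
    exact sub_le_sub (hℓL _ _)
      (mul_le_mul_of_nonneg_left (ha ⟨y', rfl⟩) (one_div_pos.2 hρ).le)
  have hsup := universallyMeasurable_iSup
    (F := fun (p : Ω × X × Y) y' => ℓ y' p.2.2 - (1 / ρ) * r p.1 y' p.2.1)
    ((hℓ.comp (measurable_snd.prodMk measurable_fst.snd.snd)).sub (hr'.const_mul _)) hbddF
  intro μ _
  refine (((hsup μ).add ((hinf μ).const_mul (1 / ρ))).min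
    (aemeasurable_const (b := L))).congr (.of_forall fun p => ?_)
  simp only [surrogateLoss, Pi.add_apply]
  rw [ciSup_add (hbddF p)]
  congr 2
  funext y'
  rw [gap]
  ring

end Surrogate

end ECRM

/-! ### The generalization bound -/

theorem mainTheorem1
    {X Y H : Type*} [MeasurableSpace X] [MeasurableSpace Y] [StandardBorelSpace Y]
    -- the distribution of `(X, Y)`, and the size of the i.i.d. training sample
    (μ : Measure (X × Y)) [IsProbabilityMeasure μ] (m : ℕ) (hm : 0 < m)
    -- the loss, with values in `[0, L]`
    (ℓ : Y → Y → ℝ) (hℓ : Measurable (Function.uncurry ℓ)) (L : ℝ)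
    (hℓ_nonneg : ∀ y y', 0 ≤ ℓ y y') (hℓ_le : ∀ y y', ℓ y y' ≤ L)
    -- the kernel `k` and its reproducing kernel Hilbert space `H`
    [NormedAddCommGroup H] [InnerProductSpace ℝ H] [CompleteSpace H] [RKHS ℝ H X ℝ]
    (k : X → X → ℝ) (hkH : ∀ x x', RKHS.kernel H x x' 1 = k x x')
    (hk : Measurable (Function.uncurry k)) (κ : ℝ) (hκ : ∀ x, k x x ≤ κ)
    (ρ lam δ : ℝ) (hρ : 0 < ρ) (hlam : 0 < lam) (hδ0 : 0 < δ) (hδ1 : δ < 1)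
    -- the estimated conditional risk and the predictor, as functions of the training sample
    (R : (Fin m → X × Y) → Y → H) (hR : ∀ S, ECRM.IsRiskEstimate ℓ lam S (R S))
    (h : (Fin m → X × Y) → X → Y → Y)
    (hh : ∀ S, ECRM.IsPredictor (fun y x => R S y x) (h S))
    (hh_meas : ∀ S, AEMeasurable (fun z : X × Y => ℓ (h S z.1 z.2) z.2) μ)
    (ν : ℝ) (hν : ν = κ / lam + (κ / lam) ^ (3 / 2 : ℝ)) :
    ∃ E : Set (Fin m → X × Y), MeasurableSet E ∧
      ENNReal.ofReal (1 - δ) ≤ Measure.pi (fun _ : Fin m => μ) E ∧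
      ∀ S ∈ E,
        ECRM.expectedRisk ℓ μ (h S) ≤
          ECRM.empiricalSurrogateRisk ℓ L ρ (fun y x => R S y x) S
            + 4 * L * ν / (ρ * m)
            + L * (8 * ν / ρ + 1) * Real.sqrt (Real.log (1 / δ) / (2 * m)) := by

  obtain ⟨z₀⟩ := nonempty_of_isProbabilityMeasure μ
  have hκ0 : 0 ≤ κ := by
    refine le_trans ?_ (hκ z₀.1)
    rw [← hkH, ← RKHS.kerFun_apply, ← ECRM.inner_kerFun_one]
    exact real_inner_self_nonneg
  have hL0 : 0 ≤ L := (hℓ_nonneg z₀.2 z₀.2).trans (hℓ_le z₀.2 z₀.2)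
  have hm' : (0 : ℝ) < m := by exact_mod_cast hm
  have hν0 : 0 ≤ ν := by rw [hν]; positivity
  let T : (Fin m → X × Y) → X × Y → ℝ := fun S z =>
    ECRM.surrogateLoss ℓ L ρ (fun y x => R S y x) z.1 z.2
  have hbdd (S : Fin m → X × Y) (x : X) : BddBelow (Set.range fun y => R S y x) :=
    ECRM.bddBelow_of_forall_le (R := fun y x => R S y x) fun y' => hh S x z₀.2 y'
  have hrisk (S : Fin m → X × Y) (z : X × Y) : ℓ (h S z.1 z.2) z.2 ≤ T S z :=
    ECRM.le_surrogateLoss_of_minimizer hρ hℓ_le (hh S z.1 z.2) z.2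
  have hT0 (S : Fin m → X × Y) (z : X × Y) : 0 ≤ T S z := (hℓ_nonneg _ _).trans (hrisk S z)
  have hTL (S : Fin m → X × Y) (z : X × Y) : T S z ≤ L := min_le_right _ _
  have hT : ECRM.UniversallyMeasurable (Function.uncurry T) :=
    ECRM.universallyMeasurable_surrogateLoss (r := fun S y x => R S y x) hℓ hρ hℓ_le
      (ECRM.measurable_riskEstimate hR hm hlam hℓ hk hkH) hbdd
  have hstab (S : Fin m → X × Y) (i : Fin m) (z' z : X × Y) :
      |T (Function.update S i z') z - T S z| ≤ 4 * L * ν / (ρ * m) := by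
    refine (ECRM.abs_surrogateLoss_sub_le hρ hℓ_le (hbdd _ _) (hbdd _ _) (fun y =>
      (hR S).abs_sub_update_le (hR _) hm hlam hℓ_nonneg hℓ_le hkH hκ0 hκ y z.1) z.2).trans_eq ?_
    rw [← hν]
    field_simp
    ring
  have hExp (S : Fin m → X × Y) : ECRM.expectedRisk ℓ μ (h S) ≤ ∫ z, T S z ∂μ := by
    have hℓabs (z : X × Y) : ‖ℓ (h S z.1 z.2) z.2‖ ≤ L := by
      rw [Real.norm_eq_abs, abs_of_nonneg (hℓ_nonneg _ _)]
      exact hℓ_le _ _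
    have hTS : ECRM.UniversallyMeasurable (T S) :=
      hT.comp (measurable_prodMk_left (x := S))
    exact integral_mono (Integrable.of_bound (hh_meas S).aestronglyMeasurable L (.of_forall hℓabs))
      (hTS.integrable (C := L) (fun z => by rw [abs_of_nonneg (hT0 S z)]; exact hTL S z) μ)
      (hrisk S)
  rcases hL0.eq_or_lt with hL | hL
  · -- For `L = 0` the tail bound is vacuous, but then the loss vanishes.
    refine ⟨Set.univ, .univ, ?_, fun S _ => ?_⟩
    · rw [measure_univ, ENNReal.ofReal_le_one]
      linarith
    · have hTz (z : X × Y) : T S z = 0 := le_antisymm ((hTL S z).trans_eq hL.symm) (hT0 S z)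
      have h1 := hExp S
      have h2 : 0 ≤ ECRM.empiricalSurrogateRisk ℓ L ρ (fun y x => R S y x) S :=
        mul_nonneg (by positivity) (Finset.sum_nonneg fun i _ => hT0 S (S i))
      simp only [hTz, integral_zero] at h1
      have h3 : 4 * L * ν / (ρ * m) + L * (8 * ν / ρ + 1) * √(Real.log (1 / δ) / (2 * m)) = 0 := by
        rw [← hL]; simp
      linarith
  · obtain ⟨E, hE, hEδ, hbound⟩ := ECRM.exists_generalization_bound_of_uniform_stability μ hm hT hL
      (by positivity) hT0 hTL hstab hδ0 hδ1
    refine ⟨E, hE, hEδ, fun S hS => (hExp S).trans ((hbound S hS).trans_eq ?_)⟩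
    have hc : 2 * m * (4 * L * ν / (ρ * m)) + L = L * (8 * ν / ρ + 1) := by
      field_simp
      ring
    rw [hc]
    rfl
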